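/- A $k$-dimensional pushdown vector addition system (PVAS) is a tuple $A=(Q,\Gamma,q_0,c_0,w_0,\Delta)$ with a finite set $Q$ of states, a finite stack alphabet $\Gamma$, an initial state $q_0\in Q$, initial counters $c_0\in\mathbb N^k$, an initial stack content $w_0\in\Gamma^*$, and a finite set $\Delta\subseteq Q\times\mathbb Z^k\times\mathrm{Op}(\Gamma)\times Q$ of transitions, where $\mathrm{Op}(\Gamma)=\{\mathrm{push}(\gamma),\mathrm{pop}(\gamma),\mathrm{nop}\mid\gamma\in\Gamma\}$. A configuration is a triple in $Q\times\mathbb N^k\times\Gamma^*$. There is a step from $(p,c,u)$ to $(q,d,v)$ if some transition $(p,a,op,q)\in\Delta$ satisfies $d=c+a$ and either $op=\mathrm{push}(\gamma)$ and $v=u\gamma$, or $op=\mathrm{pop}(\gamma)$ and $u=v\gamma$, or $op=\mathrm{nop}$ and $u=v$. The reachability set is the set of configurations reachable from $(q_0,c_0,w_0)$ by finitely many steps. The PVAS is bounded if its reachability set is finite; it is counter-bounded if the set of vectors $c$ such that some $(q,c,w)$ is reachable is finite; it is stack-bounded if the set of words $w$ such that some $(q,c,w)$ is reachable is finite. The (counter-,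 stack-) boundedness problem asks whether a given PVAS is (counter-, stack-) bounded. A PVAS is given as a word that declares $k$, $|Q|$ and $|\Gamma|$ in unary and then lists $q_0$, $c_0$, $w_0$ and the transitions, with all numbers in binary. **Lemma.** 1. There is a function $f$ on words, computable in logarithmic space, such that for every $k\ge 1$, $f$ maps every encoding of a $k$-dimensional PVAS $A$ to an encoding of a $k$-dimensional PVAS $A'$ such that $A$ is bounded if and only if $A'$ is counter-bounded. 2. There is a function $g$ on words, computable in logarithmic space, such that for every $k\ge 0$, $g$ maps every encoding of a $k$-dimensional PVAS $A$ to an encoding of a $k$-dimensional PVAS $A'$ such that $A$ is bounded if and only if $A'$ is stack-bounded. Here a function is computable in logarithmic space if a single deterministic Turing machine with a read-only two-way input tape, finitely many work tapes and a write-only one-way output tape computes it on all the encodings in question, visiting $O(\log|x|)$ work tape cells on input $x$. -/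

import Mathlib

/-! ## Pushdown vector addition systems -/

/-- The stack operations over a stack alphabet `Γ`. -/
inductive StackOp (Γ : Type*) where
  | push (γ : Γ)
  | pop (γ : Γ)
  | nop

/-- A transition, i.e. an element of `Q × ℤ^k × Op(Γ) × Q`. -/
structure PVASTransition (k : ℕ) (Q Γ : Type*) where
  source : Q
  action : Fin k → ℤ
  op : StackOp Γ
  target : Q

/-- A `k`-dimensional pushdown vector addition system with states `Q` and stack alphabet `Γ`. -/
structure PVAS (k : ℕ) (Q Γ : Type*) where
  initState : Q
  initCounters : Fin k → ℕ
  initStack : List Γ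
  transitions : Finset (PVASTransition k Q Γ)

/-- A configuration `(q, c, w)`; the top of the stack is the right end of the word `w`. -/
structure PVASConfig (k : ℕ) (Q Γ : Type*) where
  state : Q
  counters : Fin k → ℕ
  stack : List Γ

/-- `op.Rel u v`: the operation `op` transforms the stack content `u` into `v`. -/
def StackOp.Rel {Γ : Type*} : StackOp Γ → List Γ → List Γ → Prop
  | .push γ, u, v => v = u ++ [γ]
  | .pop γ, u, v => u = v ++ [γ]
  | .nop, u, v => u = v

namespace PVAS

variable {k : ℕ} {Q Γ : Type*}

/-- The step relation. Counters are natural numbers before and after the step. -/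
def Step (A : PVAS k Q Γ) (x y : PVASConfig k Q Γ) : Prop :=
  ∃ t ∈ A.transitions, t.source = x.state ∧ t.target = y.state ∧
    (∀ i, (y.counters i : ℤ) = (x.counters i : ℤ) + t.action i) ∧
    t.op.Rel x.stack y.stack

/-- The reachability set. -/
def reachSet (A : PVAS k Q Γ) : Set (PVASConfig k Q Γ) :=
  {x | Relation.ReflTransGen A.Step ⟨A.initState, A.initCounters, A.initStack⟩ x}

/-- The reachability set is finite. -/
def Bounded (A : PVAS k Q Γ) : Prop :=
  A.reachSet.Finite

/-- Only finitely many counter vectors occur in reachable configurations. -/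
def CounterBounded (A : PVAS k Q Γ) : Prop :=
  {c : Fin k → ℕ | ∃ q w, (⟨q, c, w⟩ : PVASConfig k Q Γ) ∈ A.reachSet}.Finite

/-- Only finitely many stack contents occur in reachable configurations. -/
def StackBounded (A : PVAS k Q Γ) : Prop :=
  {w : List Γ | ∃ q c, (⟨q, c, w⟩ : PVASConfig k Q Γ) ∈ A.reachSet}.Finite

end PVAS

/-! ## Encoding of systems as words -/

/-- The finite alphabet over which systems are written down. -/
inductive Letter where
  | zero | one | comma | done | plus | minus | push | pop | nop

/-- A natural number in binary (least significant bit first), followed by a comma. -/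
def encodeBinary (a : ℕ) : List Letter :=
  a.bits.map (fun b => if b then Letter.one else Letter.zero) ++ [Letter.comma]

/-- A natural number in unary, followed by a comma. -/
def encodeUnary (a : ℕ) : List Letter :=
  List.replicate a Letter.one ++ [Letter.comma]

/-- An integer: its sign, then its absolute value in binary. -/
def encodeInteger (a : ℤ) : List Letter :=
  (if a < 0 then Letter.minus else Letter.plus) :: encodeBinary a.natAbs

def encodeStackOp {m : ℕ} : StackOp (Fin m) → List Letter
  | .push γ => Letter.push :: encodeBinary γ
  | .pop γ => Letter.pop :: encodeBinary γ
  | .nop => [Letter.nop]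

def encodeTransition {k n m : ℕ} (t : PVASTransition k (Fin n) (Fin m)) : List Letter :=
  encodeBinary t.source ++ (List.ofFn t.action).flatMap encodeInteger ++
    encodeStackOp t.op ++ encodeBinary t.target

namespace PVAS

/-- The word `x` encodes `A`. The dimension, the number of states and the number of stack symbols
are declared in unary (the size of a system is at least `k + |Q| + |Γ|`); all other numbers are in
binary. The transitions are listed without repetition, in any order. -/
def EncodedBy {k n m : ℕ} (A : PVAS k (Fin n) (Fin m)) (x : List Letter) : Prop :=
  ∃ l : List (PVASTransition k (Fin n) (Fin m)), l.Nodup ∧ (∀ t, t ∈ l ↔ t ∈ A.transitions) ∧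
    x = encodeUnary k ++ encodeUnary n ++ encodeUnary m ++
      encodeBinary A.initState ++
      (List.ofFn A.initCounters).flatMap encodeBinary ++
      A.initStack.flatMap (fun γ => encodeBinary γ) ++ [Letter.done] ++
      l.flatMap encodeTransition ++ [Letter.done]

end PVAS

/-! ## Computation in logarithmic space -/

inductive HeadMove where
  | left | stay | right

/-- What the input head reads: a letter of the input, or one of the two end markers. -/
inductive InputSymbol (α : Type) where
  | leftEnd
  | letter (a : α)
  | rightEnd

/-- The effect of one step of a transducer with `t` work tapes. -/
structure TransducerAction (α State Work : Type) (t : ℕ) where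
  next : State
  inputMove : HeadMove
  write : Fin t → Work
  workMove : Fin t → HeadMove
  output : Option α

/-- A deterministic Turing machine with a read-only two-way input tape, `tapes` read-write work
tapes (infinite to the right) and a write-only one-way output tape; input and output are words
over `α`. The machine halts when `trans` returns `none`. -/
structure Transducer (α : Type) where
  State : Type
  finite_state : Finite State
  Work : Type
  finite_work : Finite Work
  tapes : ℕ
  start : State
  blank : Work
  trans : State → InputSymbol α → (Fin tapes → Work) →
    Option (TransducerAction α State Work tapes)

namespace Transducer

variable {α : Type}

structure Config (M : Transducer α) where
  state : M.State
  inputPos : ℕ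
  workPos : Fin M.tapes → ℕ
  content : Fin M.tapes → ℕ → M.Work
  output : List α

/-- Cell `0` of the input tape holds the left end marker, cells `1, …, |x|` hold the input `x`,
and cell `|x| + 1` holds the right end marker. -/
def readInput (x : List α) : ℕ → InputSymbol α
  | 0 => .leftEnd
  | p + 1 => match x[p]? with
    | some a => .letter a
    | none => .rightEnd

/-- Work heads do not move left of cell `0`. -/
def moveWork : HeadMove → ℕ → ℕ
  | .left, p => p - 1
  | .stay, p => p
  | .right, p => p + 1

/-- The input head stays between the end markers. -/
def moveInput (x : List α) (d : HeadMove) (p : ℕ) : ℕ :=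
  min (moveWork d p) (x.length + 1)

def initial (M : Transducer α) : M.Config where
  state := M.start
  inputPos := 0
  workPos := fun _ => 0
  content := fun _ _ => M.blank
  output := []

/-- One step on input `x`; `none` if the machine halts. -/
def step (M : Transducer α) (x : List α) (c : M.Config) : Option M.Config :=
  (M.trans c.state (readInput x c.inputPos) (fun i => c.content i (c.workPos i))).map fun a =>
    { state := a.next
      inputPos := moveInput x a.inputMove c.inputPos
      workPos := fun i => moveWork (a.workMove i) (c.workPos i)
      content := fun i => Function.update (c.content i) (c.workPos i) (a.write i)
      output := c.output ++ a.output.toList }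

/-- On input `x` the machine halts with output `y`, and throughout the run the head of every work
tape stays on the first `s` cells of its tape. -/
def ComputesWithin (M : Transducer α) (x y : List α) (s : ℕ) : Prop :=
  ∃ c : M.Config,
    Relation.ReflTransGen (fun a b => M.step x a = some b ∧ ∀ i, b.workPos i < s) M.initial c ∧
      M.step x c = none ∧ c.output = y

end Transducer

/-- On the inputs in `D`, the function `f` is computed by a single transducer that visits
`O(log |x|)` work tape cells on input `x`. -/
def LogspaceComputableOn {α : Type} (D : Set (List α)) (f : List α → List α) : Prop :=
  ∃ (M : Transducer α) (C : ℕ), ∀ x ∈ D, M.ComputesWithin x (f x) (C * (Nat.log 2 x.length + 1))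

/-! ## Decision problems and reductions -/

/-- An instance of a decision problem for systems: a system of some dimension whose states and
stack symbols are numbered. -/
structure PVASInstance where
  dim : ℕ
  numStates : ℕ
  numSymbols : ℕ
  system : PVAS dim (Fin numStates) (Fin numSymbols)

/-- On the instances in `D`, the problem `P` is reducible in logarithmic space to the problem `R`
by a reduction that leaves the dimension unchanged. -/
def LogspaceReducibleOn (D : Set PVASInstance) (P R : PVASInstance → Prop) : Prop :=
  ∃ f : List Letter → List Letter,
    LogspaceComputableOn {x | ∃ I ∈ D, I.system.EncodedBy x} f ∧
    ∀ I ∈ D, ∀ x, I.system.EncodedBy x →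
      ∃ J : PVASInstance, J.system.EncodedBy (f x) ∧ J.dim = I.dim ∧ (P I ↔ R J)

/-! One construction serves both parts. Add a fresh state and a fresh stack symbol to `A`. Every old
state has a transition into the fresh state, which is never left. There, popping an old symbol adds
one to every counter, and any counter can be decremented while the fresh symbol is pushed.

States and symbols are finite in number, so a system is bounded as soon as the counters and the
stack height are. Emptying a stack of height `h` in the fresh state leaves every counter at least
`h`; if `k ≥ 1`, a bound on the counters of the extension therefore bounds `A`
(`bounded_of_counterBounded`). Draining a counter onto the stack makes the stack at least as high as
that counter was, so a bound on the stack also bounds `A` (`bounded_of_stackBounded`). Conversely,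
let an old symbol weigh `k + 1`, and a fresh symbol or a counter unit weigh 1. In the fresh state
the total weight never grows, so reachable configurations of the extension weigh no more than those
of `A` (`reachSet_extend`, `bounded_extend`).

As for space, old states and symbols keep their numbers. The new encoding is thus the old one with
two unary declarations lengthened by one and three simple lists of transitions inserted before the
last letter. A machine with five binary registers, none exceeding the input length, writes it
(`machine_computesWithin`). It is assembled from fragments with one entry and one exit, whose runs
compose under sequencing, branching and looping. -/

/-! ## Structured programs for transducers -/

/-- The work alphabet: `none` is the blank, `some none` marks cell `0`, `some (some b)` is a bit. -/
abbrev Cell := Option (Option Bool)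

/-- A transducer configuration without its control state. -/
@[ext]
structure Memory (t : ℕ) where
  inputPos : ℕ
  heads : Fin t → ℕ
  content : Fin t → ℕ → Cell
  output : List Letter

namespace Memory

variable {t : ℕ}

def reads (c : Memory t) (i : Fin t) : Cell := c.content i (c.heads i)

def symbol (x : List Letter) (c : Memory t) : InputSymbol Letter :=
  Transducer.readInput x c.inputPos

def apply {S : Type} (x : List Letter) (a : TransducerAction Letter S Cell t) (c : Memory t) :
    Memory t where
  inputPos := Transducer.moveInput x a.inputMove c.inputPos
  heads := fun i => Transducer.moveWork (a.workMove i) (c.heads i)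
  content := fun i => Function.update (c.content i) (c.heads i) (a.write i)
  output := c.output ++ a.output.toList

/-- The input head is between the end markers and the work heads are on the first `b` cells. -/
def Valid (x : List Letter) (b : ℕ) (c : Memory t) : Prop :=
  c.inputPos ≤ x.length + 1 ∧ ∀ i, c.heads i < b

end Memory

/-- The part of an action that is independent of the control state. -/
abbrev Effect (t : ℕ) := TransducerAction Letter Unit Cell t

def Effect.withNext {t : ℕ} {S : Type} (a : Effect t) (l : S) :
    TransducerAction Letter S Cell t where
  next := l
  inputMove := a.inputMove
  write := a.write
  workMove := a.workMove
  output := a.output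

def Effect.idle {t : ℕ} (w : Fin t → Cell) : Effect t where
  next := ()
  inputMove := .stay
  write := w
  workMove := fun _ => .stay
  output := none

/-- A piece of a transducer with one entry and one exit; the label `none` is the exit. -/
structure Fragment (t : ℕ) where
  Label : Type
  finite_label : Finite Label
  start : Label
  trans : Label → InputSymbol Letter → (Fin t → Cell) →
    Effect t × Option Label

namespace Fragment

variable {t : ℕ} {x : List Letter} {b : ℕ}

def Step (F : Fragment t) (x : List Letter) (b : ℕ)
    (u v : Option F.Label × Memory t) : Prop :=
  ∃ l, u.1 = some l ∧ v.1 = (F.trans l (u.2.symbol x) u.2.reads).2 ∧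
    v.2 = u.2.apply x (F.trans l (u.2.symbol x) u.2.reads).1 ∧ ∀ i, v.2.heads i < b

/-- Started in memory `c`, the fragment exits with memory `d`, within space `b`. -/
def Run (F : Fragment t) (x : List Letter) (b : ℕ) (c d : Memory t) : Prop :=
  Relation.ReflTransGen (F.Step x b) (some F.start, c) (none, d)

def act (f : InputSymbol Letter → (Fin t → Cell) → Effect t) : Fragment t where
  Label := Unit
  finite_label := inferInstance
  start := ()
  trans := fun _ a w => (f a w, none)

def seq (F G : Fragment t) : Fragment t where
  Label := F.Label ⊕ G.Label
  finite_label := by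
    have := F.finite_label
    have := G.finite_label
    infer_instance
  start := .inl F.start
  trans
    | .inl l, a, w => ((F.trans l a w).1, some ((F.trans l a w).2.elim (.inr G.start) .inl))
    | .inr l, a, w => ((G.trans l a w).1, (G.trans l a w).2.map .inr)

open Classical in
noncomputable def ite (p : InputSymbol Letter → (Fin t → Cell) → Prop) (F G : Fragment t) :
    Fragment t where
  Label := Option (F.Label ⊕ G.Label)
  finite_label := by
    have := F.finite_label
    have := G.finite_label
    infer_instance
  start := none
  trans
    | none, a, w => (.idle w, some (some (if p a w then .inl F.start else .inr G.start)))
    | some (.inl l), a, w => ((F.trans l a w).1, (F.trans l a w).2.map (some ∘ .inl))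
    | some (.inr l), a, w => ((G.trans l a w).1, (G.trans l a w).2.map (some ∘ .inr))

-- The label `none` of the loop is its test. The exit of `F` is also `none`, so wrapping it in
-- `some` sends control back to the test.
open Classical in
noncomputable def loop (p : InputSymbol Letter → (Fin t → Cell) → Prop) (F : Fragment t) :
    Fragment t where
  Label := Option F.Label
  finite_label := by
    have := F.finite_label
    infer_instance
  start := none
  trans
    | none, a, w => (.idle w, if p a w then some (some F.start) else none)
    | some l, a, w => ((F.trans l a w).1, some (F.trans l a w).2)

theorem apply_idle {c : Memory t} (hc : c.Valid x b) : c.apply x (Effect.idle c.reads) = c := by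
  ext1
  · simpa [Memory.apply, Effect.idle, Transducer.moveInput, Transducer.moveWork] using hc.1
  · rfl
  · funext i
    exact Function.update_eq_self _ _
  · simp [Memory.apply, Effect.idle]

theorem run_act {f : InputSymbol Letter → (Fin t → Cell) → Effect t} {c d : Memory t}
    (hd : c.apply x (f (c.symbol x) c.reads) = d) (hb : ∀ i, d.heads i < b) :
    (act f).Run x b c d := by
  subst hd
  exact .single ⟨(), rfl, rfl, rfl, hb⟩

/-- Each combinator contains its parts up to a renaming `φ` of labels. The image of the exit is
where control continues: the start of the next part, the loop test, or the exit of the whole. -/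
theorem Run.embed {F G : Fragment t} {c d : Memory t} (h : F.Run x b c d)
    (φ : Option F.Label → Option G.Label)
    (hφ : ∀ l, ∃ l', φ (some l) = some l' ∧
      ∀ a w, G.trans l' a w = ((F.trans l a w).1, φ (F.trans l a w).2)) :
    Relation.ReflTransGen (G.Step x b) (φ (some F.start), c) (φ none, d) := by
  refine Relation.ReflTransGen.lift (r := F.Step x b) (p := G.Step x b)
    (fun u => (φ u.1, u.2)) ?_ _ _ h
  rintro ⟨_, c⟩ ⟨_, c'⟩ ⟨l, rfl, hv, hm, hb⟩
  obtain ⟨l', hl', h'⟩ := hφ l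
  refine ⟨l', hl', ?_, ?_, hb⟩
  · simp only at hv
    simp only [h', hv]
  · simpa only [h'] using hm

theorem Run.seq {F G : Fragment t} {c d e : Memory t} (h₁ : F.Run x b c d) (h₂ : G.Run x b d e) :
    (F.seq G).Run x b c e :=
  (h₁.embed (G := F.seq G) (fun u => some (u.elim (.inr G.start) .inl))
    fun l => ⟨.inl l, rfl, fun _ _ => rfl⟩).trans
  (h₂.embed (G := F.seq G) (Option.map .inr) fun l => ⟨.inr l, rfl, fun _ _ => rfl⟩)

section Branching

variable {p : InputSymbol Letter → (Fin t → Cell) → Prop} {F G : Fragment t} {c d e : Memory t}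

theorem run_ite_pos (hp : p (c.symbol x) c.reads) (hc : c.Valid x b) (h : F.Run x b c d) :
    (ite p F G).Run x b c d := by
  have h' := h.embed (G := ite p F G) (Option.map (some ∘ .inl))
    fun l => ⟨some (.inl l), rfl, fun _ _ => rfl⟩
  refine .head ⟨none, rfl, ?_, (apply_idle hc).symm, hc.2⟩ h'
  simp [ite, hp]

theorem run_ite_neg (hp : ¬ p (c.symbol x) c.reads) (hc : c.Valid x b) (h : G.Run x b c d) :
    (ite p F G).Run x b c d := by
  have h' := h.embed (G := ite p F G) (Option.map (some ∘ .inr))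
    fun l => ⟨some (.inr l), rfl, fun _ _ => rfl⟩
  refine .head ⟨none, rfl, ?_, (apply_idle hc).symm, hc.2⟩ h'
  simp [ite, hp]

theorem run_loop_neg (hp : ¬ p (c.symbol x) c.reads) (hc : c.Valid x b) :
    (loop p F).Run x b c c := by
  refine .single ⟨none, rfl, ?_, (apply_idle hc).symm, hc.2⟩
  simp [loop, hp]

theorem run_loop_pos (hp : p (c.symbol x) c.reads) (hc : c.Valid x b) (h : F.Run x b c d)
    (h' : (loop p F).Run x b d e) : (loop p F).Run x b c e := by
  have h₁ := h.embed (G := loop p F) some fun l => ⟨some l, rfl, fun _ _ => rfl⟩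
  refine .head ⟨none, rfl, ?_, (apply_idle hc).symm, hc.2⟩ (h₁.trans h')
  simp [loop, hp]

end Branching

def toTransducer (F : Fragment t) : Transducer Letter where
  State := Option F.Label
  finite_state := by
    have := F.finite_label
    infer_instance
  Work := Cell
  finite_work := inferInstance
  tapes := t
  start := some F.start
  blank := none
  trans
    | none, _, _ => none
    | some l, a, w => some ((F.trans l a w).1.withNext (F.trans l a w).2)

def emptyMemory (t : ℕ) : Memory t := ⟨0, fun _ => 0, fun _ _ => none, []⟩

theorem Run.computesWithin {F : Fragment t} {d : Memory t} (h : F.Run x b (emptyMemory t) d) :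
    F.toTransducer.ComputesWithin x d.output b := by
  let toConfig : Option F.Label × Memory t → F.toTransducer.Config := fun u =>
    ⟨u.1, u.2.inputPos, u.2.heads, u.2.content, u.2.output⟩
  refine ⟨toConfig (none, d), ?_, rfl, rfl⟩
  refine Relation.ReflTransGen.lift (r := F.Step x b) toConfig ?_ _ _ h
  rintro ⟨_, c⟩ ⟨_, c'⟩ ⟨l, rfl, hv, hm, hb⟩
  obtain rfl : _ = _ := hv
  obtain rfl : _ = _ := hm
  exact ⟨rfl, hb⟩

end Fragment

/-- By determinism one run extends the other, and a halted configuration has no successor. -/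
theorem Transducer.ComputesWithin.output_unique {α : Type} {M : Transducer α} {x y z : List α}
    {s s' : ℕ} (hy : M.ComputesWithin x y s) (hz : M.ComputesWithin x z s') : y = z := by
  obtain ⟨c, hc, hc', rfl⟩ := hy
  obtain ⟨d, hd, hd', rfl⟩ := hz
  have halt : ∀ {e f : M.Config}, M.step x e = none →
      Relation.ReflTransGen (fun a b => M.step x a = some b) e f → e = f := by
    intro e f he h
    rcases h.cases_head with h | ⟨g, hg, -⟩
    · exact h
    · simp [he] at hg
  replace hc := Relation.ReflTransGen.mono (p := fun a b => M.step x a = some b)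
    (fun _ _ h => h.1) _ _ hc
  replace hd := Relation.ReflTransGen.mono (p := fun a b => M.step x a = some b)
    (fun _ _ h => h.1) _ _ hd
  rcases Relation.ReflTransGen.total_of_right_unique
    (fun a b c (h : M.step x a = some b) h' => Option.some.inj (h.symm.trans h')) hc hd with h | h
  · rw [halt hc' h]
  · rw [halt hd' h]

/-! ## Binary registers on the work tapes -/

/-- A work tape holding the word `l` behind the mark in cell `0`. -/
def tape (l : List Bool) : ℕ → Cell
  | 0 => some none
  | p + 1 => l[p]?.map some

theorem tape_eq_mark_iff {l : List Bool} {p : ℕ} : tape l p = some none ↔ p = 0 := by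
  cases p <;> simp [tape]

theorem tape_append (l m : List Bool) : tape (l ++ m) (l.length + 1) = m.head?.map some := by
  cases m <;> simp [tape]

theorem tape_length (l : List Bool) : tape l (l.length + 1) = none := by
  simpa using tape_append l []

theorem update_tape_append (l m : List Bool) (a c : Bool) :
    Function.update (tape (l ++ a :: m)) (l.length + 1) (some (some c)) = tape (l ++ c :: m) := by
  funext p
  cases p with
  | zero => simp [tape]
  | succ p =>
    rcases lt_trichotomy p l.length with h | rfl | h
    · simp [Function.update, tape, h.ne, List.getElem?_append_left h]
    · simp [tape]
    · obtain ⟨j, rfl⟩ := Nat.exists_eq_add_of_lt h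
      have : l.length + j + 1 - l.length = j + 1 := by omega
      simp [Function.update, tape, this, List.getElem?_append_right,
        show l.length ≤ l.length + j + 1 by omega, show l.length + j + 1 ≠ l.length by omega]

theorem update_tape_length (l : List Bool) (c : Bool) :
    Function.update (tape l) (l.length + 1) (some (some c)) = tape (l ++ [c]) := by
  funext p
  cases p with
  | zero => simp [tape]
  | succ p =>
    rcases lt_trichotomy p l.length with h | rfl | h
    · simp [Function.update, tape, h.ne, List.getElem?_append_left h]
    · simp [tape]
    · have h₁ : l.length + 1 ≤ p := h
      simp [Function.update, tape, h.ne', h.le, List.getElem?_eq_none, h₁]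

theorem update_tape_concat (l : List Bool) (c : Bool) :
    Function.update (tape (l ++ [c])) (l.length + 1) none = tape l := by
  rw [← update_tape_length, Function.update_idem, ← tape_length l, Function.update_eq_self]

/-- Addition of one, on binary representations with the least significant bit first. -/
def incBits : List Bool → List Bool
  | [] => [true]
  | false :: l => true :: l
  | true :: l => false :: incBits l

theorem bits_succ (n : ℕ) : (n + 1).bits = incBits n.bits := by
  induction n using Nat.strong_induction_on with
  | _ n ih =>
    rcases Nat.even_or_odd' n with ⟨m, rfl | rfl⟩
    · rcases eq_or_ne m 0 with rfl | hm
      · simp [incBits]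
      · rw [Nat.bit1_bits, Nat.bit0_bits m hm]
        rfl
    · rw [Nat.bit1_bits, show 2 * m + 1 + 1 = 2 * (m + 1) by ring, Nat.bit0_bits _ (by omega),
        ih m (by omega)]
      rfl

theorem bits_inj {m n : ℕ} : m.bits = n.bits ↔ m = n := by
  refine ⟨fun h => ?_, fun h => h ▸ rfl⟩
  have := Nat.digits_two_eq_bits m
  rwa [h, ← Nat.digits_two_eq_bits, Nat.digits_inj_iff] at this

namespace Fragment

variable {t : ℕ} {x : List Letter} {b : ℕ}

/-- The memory in which the work tapes hold the words `T`. -/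
def mem (x : List Letter) (pos : ℕ) (h : Fin t → ℕ) (T : Fin t → List Bool) (out : List Letter) :
    Memory t :=
  ⟨min pos (x.length + 1), h, fun i => tape (T i), out⟩

/-- The heads `r` and `s` are in cell `p`, all others in cell `0`. -/
def headsAt (r s : Fin t) (p : ℕ) : Fin t → ℕ :=
  fun i => if i = r ∨ i = s then p else 0

theorem headsAt_zero (r s : Fin t) : headsAt r s 0 = fun _ => 0 := by
  funext i
  simp [headsAt]

theorem headsAt_lt {r s : Fin t} {p : ℕ} (hp : p < b) (i : Fin t) : headsAt r s p i < b := by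
  unfold headsAt
  split_ifs <;> omega

variable {pos p : ℕ} {r s : Fin t} {T : Fin t → List Bool} {out : List Letter}

theorem mem_valid {h : Fin t → ℕ} (hh : ∀ i, h i < b) : (mem x pos h T out).Valid x b :=
  ⟨min_le_right _ _, hh⟩

theorem mem_valid_headsAt (hp : p < b) : (mem x pos (headsAt r s p) T out).Valid x b :=
  mem_valid (headsAt_lt hp)

theorem reads_left : (mem x pos (headsAt r s p) T out).reads r = tape (T r) p := by
  simp [Memory.reads, mem, headsAt]

theorem reads_right : (mem x pos (headsAt r s p) T out).reads s = tape (T s) p := by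
  simp [Memory.reads, mem, headsAt]

/-- Emit a letter that depends on the input symbol and move the input head. -/
def scan (t : ℕ) (o : InputSymbol Letter → Option Letter) (d : HeadMove) : Fragment t :=
  act fun a w => ⟨(), d, w, fun _ => .stay, o a⟩

def emit (t : ℕ) (a : Letter) : Fragment t :=
  scan t (fun _ => some a) .stay

/-- Emit a letter that depends on the symbol read by head `r` and move the heads `r` and `s`. -/
def shift (r s : Fin t) (o : Cell → Option Letter) (d : HeadMove) : Fragment t :=
  act fun _ w => ⟨(), .stay, w, fun i => if i = r ∨ i = s then d else .stay, o (w r)⟩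

/-- Write a symbol on tape `r` and move its head. -/
def put (r : Fin t) (a : Cell) (d : HeadMove) : Fragment t :=
  -- The repeated disjunct matches the form of `headsAt r r`.
  act fun _ w => ⟨(), .stay, Function.update w r a, fun i => if i = r ∨ i = r then d else .stay, none⟩

noncomputable def rewind (r s : Fin t) : Fragment t :=
  loop (fun _ w => w r ≠ some none) (shift r s (fun _ => none) .left)

noncomputable def increment (r : Fin t) : Fragment t :=
  (shift r r (fun _ => none) .right).seq <|
    (loop (fun _ w => w r = some (some true)) (put r (some (some false)) .right)).seq <|
      (put r (some (some true)) .stay).seq (rewind r r)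

/-- Erasing from the last bit leftwards keeps the tape a contiguous word throughout, and the mark in
cell `0` stops the head. -/
noncomputable def clear (r : Fin t) : Fragment t :=
  (shift r r (fun _ => none) .right).seq <|
    (loop (fun _ w => w r ≠ none) (shift r r (fun _ => none) .right)).seq <|
      (shift r r (fun _ => none) .left).seq <|
        loop (fun _ w => w r ≠ some none) (put r none .left)

/-- The letter that represents a bit. -/
def digit : Cell → Option Letter
  | some (some c) => some (if c then .one else .zero)
  | _ => none

noncomputable def print (r : Fin t) : Fragment t :=
  (shift r r (fun _ => none) .right).seq <|
    (loop (fun _ w => w r ≠ none) (shift r r digit .right)).seq <|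
      (rewind r r).seq (emit t .comma)

/-- Move the heads `r` and `s` to the first cell where the tapes differ, if there is one. -/
noncomputable def compare (r s : Fin t) : Fragment t :=
  (shift r s (fun _ => none) .right).seq <|
    loop (fun _ w => w r = w s ∧ w r ≠ none) (shift r s (fun _ => none) .right)

noncomputable def ifEq (r s : Fin t) (F G : Fragment t) : Fragment t :=
  (compare r s).seq <|
    ite (fun _ w => w r = w s) ((rewind r s).seq F) ((rewind r s).seq G)

/-- Run `F` while register `r` counts from `0` up to register `s`; reset `r` in the end. -/
noncomputable def forLoop (r s : Fin t) (F : Fragment t) : Fragment t :=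
  (compare r s).seq <|
    (loop (fun _ w => w r ≠ w s)
      ((rewind r s).seq <| F.seq <| (increment r).seq (compare r s))).seq <|
    (rewind r s).seq (clear r)

/-! ### Runs of the basic tape programs -/

theorem run_scan {o : InputSymbol Letter → Option Letter} (hb : 0 < b) :
    (scan t o .right).Run x b (mem x pos (fun _ => 0) T out)
      (mem x (pos + 1) (fun _ => 0) T
        (out ++ (o (Transducer.readInput x (min pos (x.length + 1)))).toList)) := by
  refine run_act ?_ (fun _ => hb)
  ext1
  · simp only [Memory.apply, mem, Transducer.moveInput, Transducer.moveWork]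
    omega
  · rfl
  · funext i
    exact Function.update_eq_self _ _
  · rfl

theorem run_emit {a : Letter} (hb : 0 < b) :
    (emit t a).Run x b (mem x pos (fun _ => 0) T out) (mem x pos (fun _ => 0) T (out ++ [a])) := by
  refine run_act ?_ (fun _ => hb)
  ext1
  · simp [Memory.apply, mem, Transducer.moveInput, Transducer.moveWork]
  · rfl
  · funext i
    exact Function.update_eq_self _ _
  · rfl

theorem run_shift {o : Cell → Option Letter} {d : HeadMove} (hp : Transducer.moveWork d p < b) :
    (shift r s o d).Run x b (mem x pos (headsAt r s p) T out)
      (mem x pos (headsAt r s (Transducer.moveWork d p)) T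
        (out ++ (o (tape (T r) p)).toList)) := by
  refine run_act ?_ (headsAt_lt hp)
  ext1
  · simp [Memory.apply, mem, Transducer.moveInput, Transducer.moveWork]
  · funext i
    by_cases hi : i = r ∨ i = s <;>
      simp [Memory.apply, mem, headsAt, hi, Transducer.moveWork]
  · funext i
    exact Function.update_eq_self _ _
  · simp [Memory.apply, mem, Memory.reads, headsAt]

theorem run_shift_none {d : HeadMove} (hp : Transducer.moveWork d p < b) :
    (shift r s (fun _ => none) d).Run x b (mem x pos (headsAt r s p) T out)
      (mem x pos (headsAt r s (Transducer.moveWork d p)) T out) := by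
  simpa using run_shift (x := x) (T := T) (out := out) (pos := pos) (r := r) (s := s)
    (o := fun _ => none) hp

theorem run_put {a : Cell} {d : HeadMove} {l l' : List Bool}
    (hl : Function.update (tape l) p a = tape l') (hp : Transducer.moveWork d p < b) :
    (put r a d).Run x b (mem x pos (headsAt r r p) (Function.update T r l) out)
      (mem x pos (headsAt r r (Transducer.moveWork d p)) (Function.update T r l') out) := by
  refine run_act ?_ (headsAt_lt hp)
  ext1
  · simp [Memory.apply, mem, Transducer.moveInput, Transducer.moveWork]
  · funext i
    by_cases hi : i = r <;> simp [Memory.apply, mem, headsAt, hi, Transducer.moveWork]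
  · funext i
    by_cases hi : i = r
    · subst hi
      simpa [Memory.apply, mem, headsAt] using hl
    · simp [Memory.apply, mem, hi, Memory.reads]
  · simp [Memory.apply, mem]

theorem run_rewind (hp : p < b) :
    (rewind r s).Run x b (mem x pos (headsAt r s p) T out) (mem x pos (fun _ => 0) T out) := by
  rw [← headsAt_zero r s]
  induction p with
  | zero =>
    refine run_loop_neg ?_ (mem_valid_headsAt hp)
    simp [reads_left, tape]
  | succ p ih =>
    refine run_loop_pos ?_ (mem_valid_headsAt hp) (run_shift_none (d := .left) ?_) (ih (by omega))
    · simp [reads_left, tape_eq_mark_iff]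
    · simp only [Transducer.moveWork]
      omega

/-- Here `l` is the part already passed and `m` the part into which the carry still goes. Turning a
one into a zero preserves `l ++ incBits m`; the carry halts at a zero or at the end of the word. -/
theorem run_increment_loop (m l : List Bool) (h : (l ++ incBits m).length + 1 < b) :
    ∃ l' m', l' ++ incBits m' = l ++ incBits m ∧ (m' = [] ∨ ∃ m'', m' = false :: m'') ∧
      (loop (fun _ w => w r = some (some true)) (put r (some (some false)) .right)).Run x b
        (mem x pos (headsAt r r (l.length + 1)) (Function.update T r (l ++ m)) out)
        (mem x pos (headsAt r r (l'.length + 1)) (Function.update T r (l' ++ m')) out) := by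
  have hl : l.length + 1 < b := by
    rw [List.length_append] at h
    omega
  induction m generalizing l with
  | nil =>
    refine ⟨l, [], rfl, .inl rfl, run_loop_neg ?_ (mem_valid_headsAt hl)⟩
    simp [reads_left, tape_length]
  | cons a m ih =>
    cases a with
    | false =>
      refine ⟨l, false :: m, rfl, .inr ⟨m, rfl⟩, run_loop_neg ?_ (mem_valid_headsAt hl)⟩
      simp [reads_left, tape_append]
    | true =>
      have h' : ((l ++ [false]) ++ incBits m).length + 1 < b := by
        simpa [incBits] using h
      have hl' : (l ++ [false]).length + 1 < b := by
        rw [List.length_append] at h'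
        omega
      obtain ⟨l', m', e, hm', run⟩ := ih (l ++ [false]) h' hl'
      refine ⟨l', m', by simpa [incBits] using e, hm', ?_⟩
      refine run_loop_pos ?_ (mem_valid_headsAt hl)
        (run_put (d := .right) (update_tape_append l m true false) ?_) ?_
      · simp [reads_left, tape_append]
      · simpa [Transducer.moveWork] using hl'
      · simpa [Transducer.moveWork] using run

theorem run_increment (h : (incBits (T r)).length + 1 < b) :
    (increment r).Run x b (mem x pos (fun _ => 0) T out)
      (mem x pos (fun _ => 0) (Function.update T r (incBits (T r))) out) := by
  obtain ⟨l, m, e, hm, run⟩ :=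
    run_increment_loop (r := r) (x := x) (T := T) (out := out) (pos := pos) (T r) [] (by simpa)
  rw [List.nil_append] at e
  have hb : l.length + 1 < b := by
    have := congrArg List.length e
    rw [List.length_append] at this
    omega
  have h₁ := run_shift_none (x := x) (T := T) (out := out) (pos := pos) (r := r) (s := r)
    (d := .right) (p := 0) (b := b) (by simp only [Transducer.moveWork]; omega)
  rw [headsAt_zero] at h₁
  refine h₁.seq (Run.seq (d := mem x pos (headsAt r r (l.length + 1))
    (Function.update T r (l ++ m)) out) ?_ (Run.seq
      (run_put (d := .stay) (l' := incBits (T r)) ?_ hb) (run_rewind hb)))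
  · simpa [Transducer.moveWork] using run
  · rw [← e]
    -- Either the carry runs off the end and the word grows by a bit, or it replaces a zero.
    rcases hm with rfl | ⟨m, rfl⟩
    · simpa [incBits] using update_tape_length l true
    · exact update_tape_append l m false true

theorem run_skip (o : Cell → Option Letter) (m l : List Bool) (hl : T r = l ++ m)
    (h : (T r).length + 1 < b) :
    (loop (fun _ w => w r ≠ none) (shift r r o .right)).Run x b
      (mem x pos (headsAt r r (l.length + 1)) T out)
      (mem x pos (headsAt r r ((T r).length + 1)) T
        (out ++ m.flatMap fun c => (o (some (some c))).toList)) := by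
  induction m generalizing l out with
  | nil =>
    rw [List.append_nil] at hl
    subst hl
    rw [List.flatMap_nil, List.append_nil]
    refine run_loop_neg ?_ (mem_valid_headsAt h)
    simp [reads_left, tape_length]
  | cons a m ih =>
    have h' : l.length + 1 + 1 < b := by
      simp only [hl, List.length_append, List.length_cons] at h
      omega
    refine run_loop_pos ?_ (mem_valid_headsAt (by omega)) (run_shift (d := .right) h') ?_
    · simp [reads_left, hl, tape_append]
    · simpa [Transducer.moveWork, hl, tape_append] using
        ih (l ++ [a]) (by simp [hl]) (out := out ++ (o (some (some a))).toList)

theorem run_erase (l : List Bool) (h : l.length + 1 < b) :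
    (loop (fun _ w => w r ≠ some none) (put r none .left)).Run x b
      (mem x pos (headsAt r r l.length) (Function.update T r l) out)
      (mem x pos (fun _ => 0) (Function.update T r []) out) := by
  induction l using List.reverseRecOn with
  | nil =>
    rw [← headsAt_zero r r]
    refine run_loop_neg ?_ (mem_valid_headsAt (by simp at h ⊢; omega))
    simp [reads_left, tape]
  | append_singleton l a ih =>
    rw [List.length_append, List.length_singleton] at h ⊢
    refine run_loop_pos ?_ (mem_valid_headsAt (by omega))
      (run_put (d := .left) (update_tape_concat l a) ?_) (ih (by omega))
    · simp [reads_left, tape_eq_mark_iff]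
    · simp only [Transducer.moveWork]
      omega

theorem run_clear (h : (T r).length + 1 < b) :
    (clear r).Run x b (mem x pos (fun _ => 0) T out)
      (mem x pos (fun _ => 0) (Function.update T r []) out) := by
  have h₁ := run_shift_none (x := x) (T := T) (out := out) (pos := pos) (r := r) (s := r)
    (d := .right) (p := 0) (b := b) (by simp only [Transducer.moveWork]; omega)
  rw [headsAt_zero] at h₁
  have h₂ := run_skip (x := x) (pos := pos) (out := out) (fun _ => none) (T r) [] rfl h
  rw [show ((T r).flatMap fun _ => Option.toList (none : Option Letter)) = [] by simp,
    List.append_nil] at h₂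
  have h₃ := run_erase (x := x) (r := r) (pos := pos) (out := out) (T := T) (T r) h
  rw [Function.update_eq_self] at h₃
  refine h₁.seq (h₂.seq (Run.seq (run_shift_none (d := .left) ?_) h₃))
  simp only [Transducer.moveWork]
  omega

theorem run_print (h : (T r).length + 1 < b) :
    (print r).Run x b (mem x pos (fun _ => 0) T out)
      (mem x pos (fun _ => 0) T (out ++
        ((T r).map (fun c => if c then Letter.one else Letter.zero) ++ [.comma]))) := by
  have h₁ := run_shift_none (x := x) (T := T) (out := out) (pos := pos) (r := r) (s := r)
    (d := .right) (p := 0) (b := b) (by simp only [Transducer.moveWork]; omega)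
  rw [headsAt_zero] at h₁
  have h₂ := run_skip (x := x) (pos := pos) (out := out) digit (T r) [] rfl h
  rw [show ((T r).flatMap fun c => (digit (some (some c))).toList) =
    (T r).map (fun c => if c then Letter.one else Letter.zero) by
      simp [digit, List.map_eq_flatMap]] at h₂
  rw [← List.append_assoc]
  exact h₁.seq (h₂.seq ((run_rewind h).seq (run_emit (by omega))))

theorem run_compare_loop (m n l : List Bool) (hr : T r = l ++ m) (hs : T s = l ++ n)
    (h : (T r).length + 1 < b) :
    ∃ p < b, (tape (T r) p = tape (T s) p ↔ T r = T s) ∧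
      (loop (fun _ w => w r = w s ∧ w r ≠ none) (shift r s (fun _ => none) .right)).Run x b
        (mem x pos (headsAt r s (l.length + 1)) T out) (mem x pos (headsAt r s p) T out) := by
  have hl : l.length + 1 < b := by
    rw [hr, List.length_append] at h
    omega
  by_cases hmn : ∃ a m' n', m = a :: m' ∧ n = a :: n'
  · obtain ⟨a, m, n, rfl, rfl⟩ := hmn
    obtain ⟨p, hp, e, run⟩ := run_compare_loop m n (l ++ [a]) (by simp [hr]) (by simp [hs]) h
    refine ⟨p, hp, e, run_loop_pos ?_ (mem_valid_headsAt hl)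
      (run_shift_none (d := .right) ?_) ?_⟩
    · simp [reads_left, reads_right, hr, hs, tape_append]
    · simp only [hr, List.length_append, List.length_cons] at h
      simp only [Transducer.moveWork]
      omega
    · simpa [Transducer.moveWork] using run
  -- The remainders `m` and `n` share no first bit, so the symbols under the heads agree only if
  -- both remainders are empty.
  · refine ⟨l.length + 1, hl, ?_, run_loop_neg ?_ (mem_valid_headsAt hl)⟩
    · rw [hr, hs, tape_append, tape_append]
      cases m <;> cases n <;> simp_all
      exact fun e => (hmn e.symm).elim
    · rw [reads_left, reads_right, hr, hs, tape_append, tape_append]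
      cases m <;> cases n <;> simp_all
      exact fun e => hmn e.symm
termination_by m.length

theorem run_compare (h : (T r).length + 1 < b) :
    ∃ p < b, (tape (T r) p = tape (T s) p ↔ T r = T s) ∧
      (compare r s).Run x b (mem x pos (fun _ => 0) T out) (mem x pos (headsAt r s p) T out) := by
  have h₁ := run_shift_none (x := x) (T := T) (out := out) (pos := pos) (r := r) (s := s)
    (d := .right) (p := 0) (b := b) (by simp only [Transducer.moveWork]; omega)
  rw [headsAt_zero] at h₁
  obtain ⟨p, hp, e, run⟩ := run_compare_loop (x := x) (pos := pos) (out := out) (T r) (T s) []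
    rfl rfl h
  exact ⟨p, hp, e, h₁.seq run⟩

end Fragment

/-! ### Registers as numbers, counting loops and copying of the input -/

namespace Fragment

variable {t : ℕ} {x : List Letter} {b pos : ℕ} {out : List Letter} {regs : Fin t → ℕ} {r s : Fin t}

/-- The memory in which the work tapes hold the numbers `regs` in binary. -/
def regMem (x : List Letter) (pos : ℕ) (regs : Fin t → ℕ) (out : List Letter) : Memory t :=
  mem x pos (fun _ => 0) (fun i => (regs i).bits) out

/-- The registers fit into `b` cells. -/
def Fits (b : ℕ) (regs : Fin t → ℕ) : Prop :=
  1 < b ∧ ∀ i, (regs i).bits.length + 1 < b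

/-- From the register values `regs`, the fragment emits `w` and changes nothing else. -/
def Appends (F : Fragment t) (x : List Letter) (b : ℕ) (regs : Fin t → ℕ) (w : List Letter) :
    Prop :=
  ∀ pos out, F.Run x b (regMem x pos regs out) (regMem x pos regs (out ++ w))

theorem bits_update (v : ℕ) :
    (fun i => (Function.update regs r v i).bits) =
      Function.update (fun i => (regs i).bits) r v.bits := by
  funext i
  by_cases hi : i = r
  · subst hi
    simp
  · simp [hi]

theorem length_bits_mono {u v : ℕ} (h : u ≤ v) : u.bits.length ≤ v.bits.length := by
  rw [Nat.size_eq_bits_len, Nat.size_eq_bits_len]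
  exact Nat.size_le_size h

theorem Fits.update {v : ℕ} (h : Fits b regs) (hv : v ≤ regs s) :
    Fits b (Function.update regs r v) := by
  refine ⟨h.1, fun i => ?_⟩
  by_cases hi : i = r
  · subst hi
    have := length_bits_mono hv
    have := h.2 s
    simp only [Function.update_self]
    omega
  · simpa [hi] using h.2 i

theorem run_reg_increment {v : ℕ} (hv : (v + 1).bits.length + 1 < b) :
    (increment r).Run x b (regMem x pos (Function.update regs r v) out)
      (regMem x pos (Function.update regs r (v + 1)) out) := by
  rw [regMem, regMem, bits_update, bits_update, bits_succ]
  rw [bits_succ] at hv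
  simpa using run_increment (x := x) (b := b) (pos := pos) (r := r) (out := out)
    (T := Function.update (fun i => (regs i).bits) r v.bits) (by simpa using hv)

theorem run_reg_clear {v : ℕ} (h : v.bits.length + 1 < b) :
    (clear r).Run x b (regMem x pos (Function.update regs r v) out)
      (regMem x pos (Function.update regs r 0) out) := by
  rw [regMem, regMem, bits_update, bits_update]
  simpa using run_clear (x := x) (b := b) (pos := pos) (r := r) (out := out)
    (T := Function.update (fun i => (regs i).bits) r v.bits) (by simpa using h)

theorem run_reg_compare (h : (regs r).bits.length + 1 < b) :
    ∃ p < b, (tape (regs r).bits p = tape (regs s).bits p ↔ regs r = regs s) ∧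
      (compare r s).Run x b (regMem x pos regs out)
        (mem x pos (headsAt r s p) (fun i => (regs i).bits) out) := by
  obtain ⟨p, hp, e, run⟩ := run_compare (x := x) (pos := pos) (out := out) (s := s)
    (T := fun i => (regs i).bits) h
  exact ⟨p, hp, e.trans bits_inj, run⟩

theorem appends_emit (a : Letter) (hb : 0 < b) : (emit t a).Appends x b regs [a] :=
  fun _ _ => run_emit hb

theorem appends_print (h : (regs r).bits.length + 1 < b) :
    (print r).Appends x b regs (encodeBinary (regs r)) :=
  fun _ _ => run_print h

theorem Appends.seq {F G : Fragment t} {u v : List Letter} (hF : F.Appends x b regs u)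
    (hG : G.Appends x b regs v) : (F.seq G).Appends x b regs (u ++ v) := fun pos out => by
  rw [← List.append_assoc]
  exact (hF pos out).seq (hG pos _)

/-- Emit a fixed word. -/
def word (t : ℕ) : List Letter → Fragment t
  | [] => scan t (fun _ => none) .stay
  | a :: l => (emit t a).seq (word t l)

theorem appends_word (l : List Letter) (hb : 0 < b) : (word t l).Appends x b regs l := by
  induction l with
  | nil =>
    refine fun pos out => run_act ?_ (fun _ => hb)
    ext1
    · simp [Memory.apply, regMem, mem, Transducer.moveInput, Transducer.moveWork]
    · rfl
    · funext i
      exact Function.update_eq_self _ _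
    · rfl
  | cons a l ih => exact (appends_emit a hb).seq ih

theorem appends_ifEq {F G : Fragment t} {u v : List Letter} (h : (regs r).bits.length + 1 < b)
    (hF : F.Appends x b regs u) (hG : G.Appends x b regs v) :
    (ifEq r s F G).Appends x b regs (if regs r = regs s then u else v) := fun pos out => by
  obtain ⟨p, hp, e, run⟩ := run_reg_compare (x := x) (pos := pos) (out := out) (s := s) h
  refine run.seq ?_
  split_ifs with hrs
  · refine run_ite_pos ?_ (mem_valid_headsAt hp) ((run_rewind hp).seq (hF pos out))
    rw [reads_left, reads_right]
    exact e.2 hrs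
  · refine run_ite_neg ?_ (mem_valid_headsAt hp) ((run_rewind hp).seq (hG pos out))
    rw [reads_left, reads_right]
    exact fun h' => hrs (e.1 h')

theorem appends_forLoop {F : Fragment t} {w : ℕ → List Letter} (hrs : r ≠ s) (hr : regs r = 0)
    (hb : Fits b regs) (h : ∀ v < regs s, F.Appends x b (Function.update regs r v) (w v)) :
    (forLoop r s F).Appends x b regs ((List.range (regs s)).flatMap w) := fun pos out => by
  -- Here `d` rounds remain. The comparison belongs to the claim because each round ends with the
  -- comparison that the next test needs; the cell `p` where it stops is known only to exist.
  have key : ∀ d v out, v + d = regs s → ∃ p q, p < b ∧ q < b ∧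
      (compare r s).Run x b (regMem x pos (Function.update regs r v) out)
        (mem x pos (headsAt r s p) (fun i => (Function.update regs r v i).bits) out) ∧
      (loop (fun _ w => w r ≠ w s)
        ((rewind r s).seq <| F.seq <| (increment r).seq (compare r s))).Run x b
        (mem x pos (headsAt r s p) (fun i => (Function.update regs r v i).bits) out)
        (mem x pos (headsAt r s q) (fun i => (Function.update regs r (regs s) i).bits)
          (out ++ (List.range' v d).flatMap w)) := by
    intro d
    induction d with
    | zero =>
      intro v out hv
      obtain rfl : v = regs s := hv
      obtain ⟨p, hp, e, run⟩ := run_reg_compare (x := x) (pos := pos) (out := out) (s := s)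
        (r := r) ((hb.update (r := r) le_rfl).2 r)
      refine ⟨p, p, hp, hp, run, ?_⟩
      rw [List.range'_zero, List.flatMap_nil, List.append_nil]
      refine run_loop_neg ?_ (mem_valid_headsAt hp)
      rw [reads_left, reads_right, not_not, e]
      simp [hrs.symm]
    | succ d ih =>
      intro v out hv
      have hv' : v < regs s := by omega
      obtain ⟨p, hp, e, run⟩ := run_reg_compare (x := x) (pos := pos) (out := out) (s := s)
        (r := r) ((hb.update (r := r) hv'.le).2 r)
      obtain ⟨p', q, hp', hq, run', run''⟩ := ih (v + 1) (out ++ w v) (by omega)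
      refine ⟨p, q, hp, hq, run, run_loop_pos ?_ (mem_valid_headsAt hp)
        ((run_rewind hp).seq ((h v hv' pos out).seq ((run_reg_increment ?_).seq run'))) ?_⟩
      · rw [reads_left, reads_right, ne_eq, e]
        simp [hrs.symm, hv'.ne]
      · simpa using (hb.update (r := r) (show v + 1 ≤ regs s by omega)).2 r
      · rwa [List.range'_succ, List.flatMap_cons, ← List.append_assoc]
  obtain ⟨p, q, -, hq, run, run'⟩ := key (regs s) 0 out (zero_add _)
  -- Register `r` starts at zero, so clearing it restores `regs`.
  have hr' : Function.update regs r 0 = regs := by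
    rw [← hr, Function.update_eq_self]
  have run'' := run_reg_clear (x := x) (b := b) (pos := pos) (regs := regs) (r := r)
    (v := regs s) (out := out ++ (List.range (regs s)).flatMap w) (hb.2 s)
  rw [hr'] at run run''
  simp only [hr'] at run'
  rw [← List.range_eq_range'] at run'
  exact run.seq (run'.seq ((run_rewind hq).seq run''))

/-- The letter under the input head. -/
def copyLetter : InputSymbol Letter → Option Letter
  | .letter a => some a
  | _ => none

def copy (t : ℕ) : Fragment t :=
  scan t copyLetter .right

theorem symbol_regMem {a : Letter} {pre suf : List Letter} (hx : x = pre ++ a :: suf)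
    (hpos : pos = pre.length + 1) : (regMem x pos regs out).symbol x = .letter a := by
  subst hx hpos
  simp [Memory.symbol, regMem, mem, Transducer.readInput]

theorem valid_regMem (hb : 0 < b) : (regMem x pos regs out).Valid x b :=
  mem_valid fun _ => hb

theorem run_copy {a : Letter} {pre suf : List Letter} (hx : x = pre ++ a :: suf)
    (hpos : pos = pre.length + 1) (hb : 0 < b) :
    (copy t).Run x b (regMem x pos regs out) (regMem x (pos + 1) regs (out ++ [a])) := by
  have := symbol_regMem (regs := regs) (out := out) hx hpos
  rw [Memory.symbol, regMem, mem] at this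
  have run := run_scan (x := x) (pos := pos) (out := out) (T := fun i => (regs i).bits)
    (o := copyLetter) hb
  rwa [this] at run

/-- Copy a block of the letter `one` and add its length to register `r`. -/
noncomputable def copyOnes (r : Fin t) : Fragment t :=
  loop (fun a _ => a = .letter .one) ((copy t).seq (increment r))

theorem run_copyOnes {a v : ℕ} {pre suf : List Letter}
    (hx : x = pre ++ List.replicate a .one ++ .comma :: suf) (hpos : pos = pre.length + 1)
    (hb : ∀ u ≤ v + a, u.bits.length + 1 < b) :
    (copyOnes r).Run x b (regMem x pos (Function.update regs r v) out)
      (regMem x (pos + a) (Function.update regs r (v + a)) (out ++ List.replicate a .one)) := by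
  have hb₀ : 0 < b := (Nat.succ_pos _).trans (hb 0 (Nat.zero_le _))
  induction a generalizing v pre pos out with
  | zero =>
    rw [List.replicate_zero, List.append_nil] at hx ⊢
    refine run_loop_neg ?_ (valid_regMem hb₀)
    simp [symbol_regMem hx hpos]
  | succ a ih =>
    have hx₁ : x = pre ++ Letter.one :: (List.replicate a .one ++ .comma :: suf) := by
      simpa [List.replicate_succ] using hx
    refine run_loop_pos (symbol_regMem hx₁ hpos) (valid_regMem hb₀)
      ((run_copy hx₁ hpos hb₀).seq (run_reg_increment (hb _ (by omega)))) ?_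
    have := ih (v := v + 1) (pre := pre ++ [.one]) (pos := pos + 1) (out := out ++ [.one])
      (by simpa using hx₁) (by simp [hpos]) (fun u hu => hb u (by omega))
    rwa [List.append_assoc, add_right_comm v, add_right_comm pos, add_assoc v, add_assoc pos,
      List.singleton_append, ← List.replicate_succ] at this

/-- Copy the input up to the next letter `done`. -/
noncomputable def copyUntilDone (t : ℕ) : Fragment t :=
  loop (fun a _ => a ≠ .letter .done) (copy t)

theorem run_copyUntilDone {u pre suf : List Letter} (hx : x = pre ++ u ++ .done :: suf)
    (hu : Letter.done ∉ u) (hpos : pos = pre.length + 1) (hb : 0 < b) :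
    (copyUntilDone t).Run x b (regMem x pos regs out) (regMem x (pos + u.length) regs (out ++ u))
      := by
  induction u generalizing pre pos out with
  | nil =>
    rw [List.append_nil] at hx ⊢
    refine run_loop_neg ?_ (valid_regMem hb)
    simp [symbol_regMem hx hpos]
  | cons a u ih =>
    rw [List.mem_cons, not_or] at hu
    have hx₁ : x = pre ++ a :: (u ++ .done :: suf) := by
      simpa using hx
    refine run_loop_pos ?_ (valid_regMem hb) (run_copy hx₁ hpos hb) ?_
    · rw [symbol_regMem hx₁ hpos]
      simpa using Ne.symm hu.1
    · have := ih (pre := pre ++ [a]) (pos := pos + 1) (out := out ++ [a])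
        (by simpa using hx₁) hu.2 (by simp [hpos])
      rwa [List.append_assoc, add_right_comm pos, add_assoc pos] at this

end Fragment

/-! ## The machine of the reduction

Registers `0`, `1`, `2` hold the dimension and the numbers of states and symbols; registers `3`
and `4` are loop counters. -/

namespace Reduction

open Fragment

/-- Transitions from every state to the fresh one. -/
noncomputable def emitEnter : Fragment 5 :=
  forLoop 3 1 <| (print 3).seq <| (forLoop 4 0 (word 5 [.plus, .comma])).seq <|
    (word 5 [.nop]).seq (print 1)

/-- Loops of the fresh state that pop a symbol and increment all counters. -/
noncomputable def emitPop : Fragment 5 :=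
  forLoop 3 2 <| (print 1).seq <| (forLoop 4 0 (word 5 [.plus, .one, .comma])).seq <|
    (word 5 [.pop]).seq <| (print 3).seq (print 1)

/-- Loops of the fresh state that decrement a counter and push the fresh symbol. -/
noncomputable def emitPush : Fragment 5 :=
  forLoop 3 0 <| (print 1).seq <|
    (forLoop 4 0 (ifEq 3 4 (word 5 [.minus, .one, .comma]) (word 5 [.plus, .comma]))).seq <|
      (word 5 [.push]).seq <| (print 2).seq (print 1)

/-- The mark in cell `0`, needed for rewinding, is written on all tapes. Every register then holds
zero, whose binary word is empty, and the input head leaves the left end marker. -/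
def initialise : Fragment 5 :=
  act fun _ _ => ⟨(), .right, fun _ => some none, fun _ => .stay, none⟩

/-- The extra `one` is emitted but not counted, so registers `1` and `2` keep the old sizes, which
are the numbers of the fresh state and symbol. The last `done` of the input is not copied but
emitted after the new transitions. -/
noncomputable def machine : Fragment 5 :=
  initialise.seq <|
    (copyOnes 0).seq <| (copy 5).seq <|
    (copyOnes 1).seq <| (emit 5 .one).seq <| (copy 5).seq <|
    (copyOnes 2).seq <| (emit 5 .one).seq <| (copy 5).seq <|
    (copyUntilDone 5).seq <| (copy 5).seq <| (copyUntilDone 5).seq <|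
    emitEnter.seq <| emitPop.seq <| emitPush.seq (emit 5 .done)

def enterWord (k n : ℕ) : List Letter :=
  (List.range n).flatMap fun q => encodeBinary q ++
    ((List.range k).flatMap (fun _ => [.plus, .comma]) ++ ([.nop] ++ encodeBinary n))

def popWord (k n m : ℕ) : List Letter :=
  (List.range m).flatMap fun γ => encodeBinary n ++
    ((List.range k).flatMap (fun _ => [.plus, .one, .comma]) ++
      ([.pop] ++ (encodeBinary γ ++ encodeBinary n)))

def pushWord (k n m : ℕ) : List Letter :=
  (List.range k).flatMap fun i => encodeBinary n ++
    ((List.range k).flatMap (fun j => if i = j then [.minus, .one, .comma] else [.plus, .comma]) ++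
      ([.push] ++ (encodeBinary m ++ encodeBinary n)))

variable {x : List Letter} {b : ℕ} {regs : Fin 5 → ℕ}

theorem appends_emitEnter (h₃ : regs 3 = 0) (h₄ : regs 4 = 0) (hb : Fits b regs) :
    emitEnter.Appends x b regs (enterWord (regs 0) (regs 1)) := by
  refine appends_forLoop (by decide) h₃ hb fun v hv => ?_
  have hf := hb.update (r := 3) hv.le
  have hb₀ : 0 < b := by have := hb.1; omega
  have := (appends_print (x := x) (hf.2 3)).seq <|
    (appends_forLoop (x := x) (r := 4) (s := 0) (by decide) (by simpa using h₄) hf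
      (fun _ _ => appends_word [.plus, .comma] hb₀)).seq <|
    (appends_word [.nop] hb₀).seq (appends_print (hf.2 1))
  simpa using this

theorem appends_emitPop (h₃ : regs 3 = 0) (h₄ : regs 4 = 0) (hb : Fits b regs) :
    emitPop.Appends x b regs (popWord (regs 0) (regs 1) (regs 2)) := by
  refine appends_forLoop (by decide) h₃ hb fun v hv => ?_
  have hf := hb.update (r := 3) hv.le
  have hb₀ : 0 < b := by have := hb.1; omega
  have := (appends_print (x := x) (hf.2 1)).seq <|
    (appends_forLoop (x := x) (r := 4) (s := 0) (by decide) (by simpa using h₄) hf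
      (fun _ _ => appends_word [.plus, .one, .comma] hb₀)).seq <|
    (appends_word [.pop] hb₀).seq <| (appends_print (hf.2 3)).seq (appends_print (hf.2 1))
  simpa using this

theorem appends_emitPush (h₃ : regs 3 = 0) (h₄ : regs 4 = 0) (hb : Fits b regs) :
    emitPush.Appends x b regs (pushWord (regs 0) (regs 1) (regs 2)) := by
  refine appends_forLoop (by decide) h₃ hb fun v hv => ?_
  have hf := hb.update (r := 3) hv.le
  have hb₀ : 0 < b := by have := hb.1; omega
  have := (appends_print (x := x) (hf.2 1)).seq <|
    (appends_forLoop (x := x) (r := 4) (s := 0) (by decide) (by simpa using h₄) hf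
      (fun u hu => appends_ifEq (r := 3) (s := 4)
        (by simpa using (hf.update (r := 4) hu.le).2 3)
        (appends_word [.minus, .one, .comma] hb₀) (appends_word [.plus, .comma] hb₀))).seq <|
    (appends_word [.push] hb₀).seq <| (appends_print (hf.2 2)).seq (appends_print (hf.2 1))
  simpa using this

theorem run_initialise (hb : 0 < b) :
    initialise.Run x b (emptyMemory 5) (regMem x 1 (fun _ => 0) []) := by
  refine run_act ?_ (fun _ => hb)
  ext1
  · simp [Memory.apply, emptyMemory, regMem, mem, Transducer.moveInput, Transducer.moveWork]
  · rfl
  · funext i p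
    cases p <;> simp [Memory.apply, emptyMemory, regMem, mem, tape]
  · rfl

/-- The words `u` and `v` are copied without being parsed, so all that matters is that they avoid
`done`. -/
theorem machine_computesWithin {k n m : ℕ} {u v : List Letter} (hu : Letter.done ∉ u)
    (hv : Letter.done ∉ v)
    (hx : x = encodeUnary k ++ encodeUnary n ++ encodeUnary m ++ u ++ [Letter.done] ++ v ++ [Letter.done])
    (hb : ∀ a ≤ x.length, a.bits.length + 2 < b) :
    machine.toTransducer.ComputesWithin x
      (encodeUnary k ++ encodeUnary (n + 1) ++ encodeUnary (m + 1) ++ u ++ [Letter.done] ++ v ++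
        enterWord k n ++ popWord k n m ++ pushWord k n m ++ [Letter.done]) b := by
  have hb₀ : 2 < b := by simpa using hb 0 (Nat.zero_le _)
  have hb₁ : 0 < b := by omega
  have hlen := congrArg List.length hx
  simp only [encodeUnary, List.length_append, List.length_replicate, List.length_singleton]
    at hlen
  have hfit : ∀ c ≤ x.length, ∀ a ≤ 0 + c, a.bits.length + 1 < b := fun c hc a ha => by
    have := hb a (by omega)
    omega
  let R₀ : Fin 5 → ℕ := fun _ => 0
  let R₁ := Function.update R₀ 0 (0 + k)
  let R₂ := Function.update R₁ 1 (0 + n)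
  let R₃ := Function.update R₂ 2 (0 + m)
  -- A register not yet counted is zero; `run_copyOnes` wants this value as an explicit update.
  have e₀ : Function.update R₀ 0 0 = R₀ := Function.update_eq_self _ _
  have e₁ : Function.update R₁ 1 0 = R₁ := Function.update_eq_self (1 : Fin 5) R₁
  have e₂ : Function.update R₂ 2 0 = R₂ := Function.update_eq_self (2 : Fin 5) R₂
  have hR : Fits b R₃ := by
    refine ⟨by omega, fun i => ?_⟩
    have hk := hfit k (by omega) k (by omega)
    have hn := hfit n (by omega) n (by omega)
    have hm := hfit m (by omega) m (by omega)
    fin_cases i <;> simp [R₃, R₂, R₁, R₀] <;> omega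
  -- The final memory is found by unification, since each link fixes the memory at which the next
  -- begins.
  have run : machine.Run x b (emptyMemory 5) _ :=
    (run_initialise hb₁).seq <|
    (e₀ ▸ run_copyOnes (r := 0) (pre := []) (a := k) (v := 0) (regs := R₀)
      (suf := encodeUnary n ++ encodeUnary m ++ u ++ [Letter.done] ++ v ++ [Letter.done])
      (by simpa [encodeUnary] using hx) rfl (hfit k (by omega))).seq <|
    (run_copy (pre := List.replicate k Letter.one) (a := .comma)
      (suf := encodeUnary n ++ encodeUnary m ++ u ++ [Letter.done] ++ v ++ [Letter.done])
      (by simpa [encodeUnary] using hx) (by simp [add_comm]) hb₁).seq <|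
    (e₁ ▸ run_copyOnes (r := 1) (pre := encodeUnary k) (a := n) (v := 0) (regs := R₁)
      (suf := encodeUnary m ++ u ++ [Letter.done] ++ v ++ [Letter.done])
      (by simpa [encodeUnary] using hx) (by simp [encodeUnary]; omega) (hfit n (by omega))).seq <|
    (appends_emit .one hb₁ _ _).seq <|
    (run_copy (pre := encodeUnary k ++ List.replicate n Letter.one) (a := .comma)
      (suf := encodeUnary m ++ u ++ [Letter.done] ++ v ++ [Letter.done])
      (by simpa [encodeUnary] using hx) (by simp [encodeUnary]; omega) hb₁).seq <|
    (e₂ ▸ run_copyOnes (r := 2) (pre := encodeUnary k ++ encodeUnary n) (a := m) (v := 0)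
      (regs := R₂) (suf := u ++ [Letter.done] ++ v ++ [Letter.done])
      (by simpa [encodeUnary] using hx) (by simp [encodeUnary]; omega) (hfit m (by omega))).seq <|
    (appends_emit .one hb₁ _ _).seq <|
    (run_copy (pre := encodeUnary k ++ encodeUnary n ++ List.replicate m Letter.one) (a := .comma)
      (suf := u ++ [Letter.done] ++ v ++ [Letter.done])
      (by simpa [encodeUnary] using hx) (by simp [encodeUnary]; omega) hb₁).seq <|
    (run_copyUntilDone (pre := encodeUnary k ++ encodeUnary n ++ encodeUnary m)
      (suf := v ++ [Letter.done]) (by simpa using hx) hu (by simp [encodeUnary]; omega) hb₁).seq <|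
    (run_copy (pre := encodeUnary k ++ encodeUnary n ++ encodeUnary m ++ u)
      (suf := v ++ [Letter.done]) (a := .done) (by simpa using hx)
      (by simp [encodeUnary]; omega) hb₁).seq <|
    (run_copyUntilDone (pre := encodeUnary k ++ encodeUnary n ++ encodeUnary m ++ u ++ [Letter.done])
      (suf := []) (by simpa using hx) hv (by simp [encodeUnary]; omega) hb₁).seq <|
    (appends_emitEnter (regs := R₃) rfl rfl hR _ _).seq <|
    (appends_emitPop rfl rfl hR _ _).seq <|
    (appends_emitPush rfl rfl hR _ _).seq (appends_emit .done hb₁ _ _)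
  have := run.computesWithin
  convert this using 1
  have r₀ : R₃ 0 = k := by simp [R₃, R₂, R₁]
  have r₁ : R₃ 1 = n := by simp [R₃, R₂, R₁]
  have r₂ : R₃ 2 = m := by simp [R₃, R₂, R₁]
  simp [regMem, mem, encodeUnary, r₀, r₁, r₂, List.replicate_succ']

end Reduction

/-! ## The extended system -/

namespace PVASConfig

theorem finite_bounded {k n m : ℕ} (B : ℕ) :
    {x : PVASConfig k (Fin n) (Fin m) | (∀ i, x.counters i ≤ B) ∧ x.stack.length ≤ B}.Finite := by
  have hc : {c : Fin k → ℕ | ∀ i, c i ≤ B}.Finite := by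
    simpa [Set.pi] using Set.Finite.pi' (fun _ : Fin k => Set.finite_Iic B)
  have hs : {w : List (Fin m) | w.length ≤ B}.Finite := List.finite_length_le _ _
  refine (((Set.finite_univ (α := Fin n)).prod (hc.prod hs)).image
    fun y => (⟨y.1, y.2.1, y.2.2⟩ : PVASConfig k (Fin n) (Fin m))).subset ?_
  rintro ⟨q, c, w⟩ ⟨h₁, h₂⟩
  exact ⟨(q, c, w), ⟨trivial, h₁, h₂⟩, rfl⟩

end PVASConfig

namespace Reduction

variable {k n m : ℕ}

def liftOp : StackOp (Fin m) → StackOp (Fin (m + 1))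
  | .push γ => .push γ.castSucc
  | .pop γ => .pop γ.castSucc
  | .nop => .nop

def liftTransition (t : PVASTransition k (Fin n) (Fin m)) :
    PVASTransition k (Fin (n + 1)) (Fin (m + 1)) :=
  ⟨t.source.castSucc, t.action, liftOp t.op, t.target.castSucc⟩

def liftConfig (x : PVASConfig k (Fin n) (Fin m)) : PVASConfig k (Fin (n + 1)) (Fin (m + 1)) :=
  ⟨x.state.castSucc, x.counters, x.stack.map Fin.castSucc⟩

def enter (k m : ℕ) (q : Fin n) : PVASTransition k (Fin (n + 1)) (Fin (m + 1)) :=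
  ⟨q.castSucc, 0, .nop, Fin.last n⟩

def popLoop (k n : ℕ) (γ : Fin m) : PVASTransition k (Fin (n + 1)) (Fin (m + 1)) :=
  ⟨Fin.last n, 1, .pop γ.castSucc, Fin.last n⟩

def pushLoop (n m : ℕ) (i : Fin k) : PVASTransition k (Fin (n + 1)) (Fin (m + 1)) :=
  ⟨Fin.last n, fun j => if i = j then -1 else 0, .push (Fin.last m), Fin.last n⟩

def extendedTransitions (l : List (PVASTransition k (Fin n) (Fin m))) :
    List (PVASTransition k (Fin (n + 1)) (Fin (m + 1))) :=
  l.map liftTransition ++ (List.finRange n).map (enter k m) ++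
    (List.finRange m).map (popLoop k n) ++ (List.finRange k).map (pushLoop n m)

theorem liftOp_injective : Function.Injective (liftOp (m := m)) := by
  intro a b h
  cases a <;> cases b <;> simp_all [liftOp]

theorem liftTransition_injective :
    Function.Injective (liftTransition (k := k) (n := n) (m := m)) := by
  rintro ⟨p, a, op, q⟩ ⟨p', a', op', q'⟩ h
  simp only [liftTransition, PVASTransition.mk.injEq, Fin.castSucc_inj] at h
  obtain ⟨rfl, rfl, h, rfl⟩ := h
  rw [liftOp_injective h]

theorem enter_injective : Function.Injective (enter (n := n) k m) := by
  intro p q h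
  simpa [enter] using h

theorem popLoop_injective : Function.Injective (popLoop (m := m) k n) := by
  intro p q h
  simpa [popLoop] using h

theorem pushLoop_injective : Function.Injective (pushLoop (k := k) n m) := by
  intro i j h
  simp only [pushLoop, PVASTransition.mk.injEq, true_and, and_true] at h
  by_contra hij
  simpa [Ne.symm hij] using congrFun h i

theorem mem_extendedTransitions {l : List (PVASTransition k (Fin n) (Fin m))}
    {t : PVASTransition k (Fin (n + 1)) (Fin (m + 1))} :
    t ∈ extendedTransitions l ↔ (∃ u ∈ l, liftTransition u = t) ∨ (∃ q, enter k m q = t) ∨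
      (∃ γ, popLoop k n γ = t) ∨ ∃ i, pushLoop n m i = t := by
  simp [extendedTransitions]

/-- Encodings list transitions without repetition. Targets separate lifted from entering
transitions, sources separate both from the loops, and operations separate the two kinds of loops.
-/
theorem nodup_extendedTransitions {l : List (PVASTransition k (Fin n) (Fin m))} (hl : l.Nodup) :
    (extendedTransitions l).Nodup := by
  refine (((hl.map liftTransition_injective).append
    ((List.nodup_finRange n).map enter_injective) ?_).append
    ((List.nodup_finRange m).map popLoop_injective) ?_).append
    ((List.nodup_finRange k).map pushLoop_injective) ?_
  all_goals
    intro t ht ht'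
    simp only [List.mem_append, List.mem_map] at ht ht'
  · obtain ⟨u, -, rfl⟩ := ht
    obtain ⟨q, -, h⟩ := ht'
    exact (Fin.castSucc_ne_last _) (congrArg PVASTransition.target h).symm
  · obtain ⟨γ, -, rfl⟩ := ht'
    rcases ht with ⟨u, -, h⟩ | ⟨u, -, h⟩ <;>
      exact (Fin.castSucc_ne_last _) (congrArg PVASTransition.source h)
  · obtain ⟨i, -, rfl⟩ := ht'
    rcases ht with (⟨u, -, h⟩ | ⟨u, -, h⟩) | ⟨u, -, h⟩
    · exact (Fin.castSucc_ne_last _) (congrArg PVASTransition.source h)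
    · exact (Fin.castSucc_ne_last _) (congrArg PVASTransition.source h)
    · simpa [popLoop, pushLoop] using congrArg PVASTransition.op h

/-- The system `A`, whose transitions are listed in `l`, with a fresh state and a fresh symbol. In
the fresh state, which can be entered at any time, every popped symbol increments all counters, and
every counter can be transferred to the stack. -/
def extend (A : PVAS k (Fin n) (Fin m)) (l : List (PVASTransition k (Fin n) (Fin m)))
    (hl : l.Nodup) : PVAS k (Fin (n + 1)) (Fin (m + 1)) where
  initState := A.initState.castSucc
  initCounters := A.initCounters
  initStack := A.initStack.map Fin.castSucc
  transitions := ⟨extendedTransitions l, nodup_extendedTransitions hl⟩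

/-! ### Correctness of the extension -/

section Correctness

variable {A : PVAS k (Fin n) (Fin m)} {l : List (PVASTransition k (Fin n) (Fin m))}
  {hl : l.Nodup}

theorem step_extend_iff {x y : PVASConfig k (Fin (n + 1)) (Fin (m + 1))} :
    (extend A l hl).Step x y ↔ ∃ t ∈ extendedTransitions l, t.source = x.state ∧
      t.target = y.state ∧ (∀ i, (y.counters i : ℤ) = (x.counters i : ℤ) + t.action i) ∧
      t.op.Rel x.stack y.stack :=
  Iff.rfl

theorem step_liftConfig (h : ∀ t, t ∈ l ↔ t ∈ A.transitions)
    {x y : PVASConfig k (Fin n) (Fin m)} (hxy : A.Step x y) :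
    (extend A l hl).Step (liftConfig x) (liftConfig y) := by
  obtain ⟨t, ht, hs, ht', hc, hop⟩ := hxy
  refine step_extend_iff.2 ⟨liftTransition t,
    mem_extendedTransitions.2 (.inl ⟨t, (h t).2 ht, rfl⟩), ?_, ?_, hc, ?_⟩
  · simp [liftTransition, liftConfig, hs]
  · simp [liftTransition, liftConfig, ht']
  · revert hop
    simp only [liftTransition, liftConfig]
    cases t.op <;> intro hop <;> simp only [StackOp.Rel] at hop <;>
      simp [liftOp, StackOp.Rel, hop]

theorem liftConfig_mem_reachSet (h : ∀ t, t ∈ l ↔ t ∈ A.transitions)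
    {x : PVASConfig k (Fin n) (Fin m)} (hx : x ∈ A.reachSet) :
    liftConfig x ∈ (extend A l hl).reachSet :=
  Relation.ReflTransGen.lift (r := A.Step) (p := (extend A l hl).Step) liftConfig
    (fun _ _ => step_liftConfig h) _ _ hx

theorem enter_mem_reachSet (h : ∀ t, t ∈ l ↔ t ∈ A.transitions)
    {x : PVASConfig k (Fin n) (Fin m)} (hx : x ∈ A.reachSet) :
    ⟨Fin.last n, x.counters, x.stack.map Fin.castSucc⟩ ∈ (extend A l hl).reachSet :=
  Relation.ReflTransGen.tail (liftConfig_mem_reachSet h hx) <| step_extend_iff.2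
    ⟨enter k m x.state, mem_extendedTransitions.2 (.inr (.inl ⟨_, rfl⟩)), rfl, rfl,
      fun i => by simp [enter, liftConfig], rfl⟩

theorem pop_mem_reachSet (w : List (Fin m)) (c : Fin k → ℕ)
    (h : ⟨Fin.last n, c, w.map Fin.castSucc⟩ ∈ (extend A l hl).reachSet) :
    ⟨Fin.last n, fun i => c i + w.length, []⟩ ∈ (extend A l hl).reachSet := by
  induction w using List.reverseRecOn generalizing c with
  | nil => simpa using h
  | append_singleton w γ ih =>
    have := ih (fun i => c i + 1) <| Relation.ReflTransGen.tail h <| step_extend_iff.2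
      ⟨popLoop k n γ, mem_extendedTransitions.2 (.inr (.inr (.inl ⟨_, rfl⟩))), rfl, rfl,
        fun i => by simp [popLoop], by simp [popLoop, StackOp.Rel]⟩
    simpa [add_assoc, add_comm 1] using this

/-- Counter `i` is drained to zero, each unit becoming one stack symbol; only the resulting height
is used later. -/
theorem push_mem_reachSet (i : Fin k) (j : ℕ) (c : Fin k → ℕ) (w : List (Fin (m + 1)))
    (hj : c i = j) (h : ⟨Fin.last n, c, w⟩ ∈ (extend A l hl).reachSet) :
    ∃ d v, v.length = w.length + j ∧ ⟨Fin.last n, d, v⟩ ∈ (extend A l hl).reachSet := by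
  induction j generalizing c w with
  | zero => exact ⟨c, w, rfl, h⟩
  | succ j ih =>
    obtain ⟨d, v, hv, hd⟩ := ih (Function.update c i j) (w ++ [Fin.last m]) (by simp) <|
      Relation.ReflTransGen.tail h <| step_extend_iff.2
        ⟨pushLoop n m i, mem_extendedTransitions.2 (.inr (.inr (.inr ⟨_, rfl⟩))), rfl, rfl,
          fun i' => by
            by_cases hi : i = i'
            · subst hi
              simp [pushLoop, hj]
            · simp [pushLoop, hi, Ne.symm hi],
          rfl⟩
    exact ⟨d, v, by simp [hv]; omega, hd⟩

/-- A quantity that no loop of the fresh state increases. -/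
def potential (x : PVASConfig k (Fin (n + 1)) (Fin (m + 1))) : ℕ :=
  ∑ i, x.counters i + (x.stack.map fun γ => if γ = Fin.last m then 1 else k + 1).sum

theorem counters_le_potential (x : PVASConfig k (Fin (n + 1)) (Fin (m + 1))) (i : Fin k) :
    x.counters i ≤ potential x :=
  (Finset.single_le_sum (f := x.counters) (fun _ _ => Nat.zero_le _) (Finset.mem_univ i)).trans
    (Nat.le_add_right _ _)

theorem length_le_potential (x : PVASConfig k (Fin (n + 1)) (Fin (m + 1))) :
    x.stack.length ≤ potential x := by
  refine le_trans ?_ (Nat.le_add_left _ _)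
  rw [← List.length_map (fun γ => if γ = Fin.last m then 1 else k + 1)]
  refine List.length_le_sum_of_one_le _ ?_
  intro a ha
  obtain ⟨γ, -, rfl⟩ := List.mem_map.1 ha
  split_ifs <;> omega

/-- Only the loops start in the fresh state. A pop loses weight `k + 1` and gains `k` from the
counters; a push exchanges one counter unit for a symbol of weight 1. -/
theorem potential_le_of_step {x y : PVASConfig k (Fin (n + 1)) (Fin (m + 1))}
    (hx : x.state = Fin.last n) (h : (extend A l hl).Step x y) :
    y.state = Fin.last n ∧ potential y ≤ potential x := by
  obtain ⟨t, ht, hs, ht', hc, hop⟩ := step_extend_iff.1 h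
  -- The actions may be negative, so the sums are compared in `ℤ`.
  have hsum : ((∑ i, y.counters i : ℕ) : ℤ) = (∑ i, x.counters i : ℕ) + ∑ i, t.action i := by
    push_cast
    rw [← Finset.sum_add_distrib]
    exact Finset.sum_congr rfl fun i _ => hc i
  rw [hx] at hs
  rcases mem_extendedTransitions.1 ht with ⟨u, -, rfl⟩ | ⟨q, rfl⟩ | ⟨γ, rfl⟩ | ⟨i, rfl⟩
  · exact absurd hs (Fin.castSucc_ne_last _)
  · exact absurd hs (Fin.castSucc_ne_last _)
  · refine ⟨ht'.symm, ?_⟩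
    have hop : x.stack = y.stack ++ [γ.castSucc] := hop
    simp only [popLoop, Pi.one_apply, Finset.sum_const, Finset.card_univ, Fintype.card_fin,
      nsmul_eq_mul, mul_one] at hsum
    simp [potential, hop, Fin.castSucc_ne_last]
    omega
  · refine ⟨ht'.symm, ?_⟩
    have hop : y.stack = x.stack ++ [Fin.last m] := hop
    simp only [pushLoop, Finset.sum_ite_eq, Finset.mem_univ, if_true] at hsum
    simp [potential, hop]
    omega

/-- A lifted transition keeps the stack free of the fresh symbol, hence comes from a step of `A`. An
entering transition keeps counters and stack, and no loop starts in an old state. -/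
theorem step_from_liftConfig (h : ∀ t, t ∈ l ↔ t ∈ A.transitions)
    {x : PVASConfig k (Fin n) (Fin m)} {y : PVASConfig k (Fin (n + 1)) (Fin (m + 1))}
    (hxy : (extend A l hl).Step (liftConfig x) y) :
    (∃ y', A.Step x y' ∧ y = liftConfig y') ∨
      y.state = Fin.last n ∧ potential y ≤ potential (liftConfig x) := by
  obtain ⟨t, ht, hs, ht', hc, hop⟩ := step_extend_iff.1 hxy
  rcases mem_extendedTransitions.1 ht with ⟨⟨p, a, op, q⟩, hu, rfl⟩ | ⟨q, rfl⟩ | ⟨γ, rfl⟩ | ⟨i, rfl⟩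
  · refine .inl ?_
    obtain ⟨yq, yc, yw⟩ := y
    obtain rfl : q.castSucc = yq := ht'
    have hs : p = x.state := Fin.castSucc_injective _ hs
    have hw : ∃ w, op.Rel x.stack w ∧ yw = w.map Fin.castSucc := by
      cases op with
      | push γ => exact ⟨x.stack ++ [γ], rfl, by
        have hop : yw = x.stack.map Fin.castSucc ++ [γ.castSucc] := hop
        simpa using hop⟩
      | nop => exact ⟨x.stack, rfl, Eq.symm hop⟩
      | pop γ =>
        have hop : x.stack.map Fin.castSucc = yw ++ [γ.castSucc] := hop
        obtain ⟨w, v, hw, rfl, hv⟩ := List.map_eq_append_iff.1 hop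
        obtain ⟨γ', rfl, hγ⟩ := List.map_eq_singleton_iff.1 hv
        rw [Fin.castSucc_injective _ hγ] at hw
        exact ⟨w, hw, rfl⟩
    obtain ⟨w, hw, rfl⟩ := hw
    exact ⟨⟨q, yc, w⟩, ⟨_, (h _).1 hu, hs, rfl, hc, hw⟩, rfl⟩
  · refine .inr ⟨ht'.symm, ?_⟩
    have hc : y.counters = x.counters := by
      funext i
      simpa [enter, liftConfig] using hc i
    have hop : x.stack.map Fin.castSucc = y.stack := hop
    simp [potential, liftConfig, hc, ← hop]
  · exact absurd hs.symm (Fin.castSucc_ne_last _)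
  · exact absurd hs.symm (Fin.castSucc_ne_last _)

/-- After the fresh state is entered, the witness `x` stays the configuration of `A` at which the
copy was left. -/
theorem reachSet_extend (h : ∀ t, t ∈ l ↔ t ∈ A.transitions)
    {y : PVASConfig k (Fin (n + 1)) (Fin (m + 1))} (hy : y ∈ (extend A l hl).reachSet) :
    ∃ x ∈ A.reachSet, y = liftConfig x ∨
      y.state = Fin.last n ∧ potential y ≤ potential (liftConfig x) := by
  induction hy with
  | refl => exact ⟨_, .refl, .inl rfl⟩
  | tail _ hyz ih =>
    obtain ⟨x, hx, rfl | ⟨hs, hp⟩⟩ := ih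
    · rcases step_from_liftConfig h hyz with ⟨x', hx', rfl⟩ | hz
      · exact ⟨x', Relation.ReflTransGen.tail hx hx', .inl rfl⟩
      · exact ⟨x, hx, .inr hz⟩
    · obtain ⟨hs', hp'⟩ := potential_le_of_step hs hyz
      exact ⟨x, hx, .inr ⟨hs', hp'.trans hp⟩⟩

theorem bounded_extend (h : ∀ t, t ∈ l ↔ t ∈ A.transitions) (hA : A.Bounded) :
    (extend A l hl).Bounded := by
  obtain ⟨B, hB⟩ := (hA.image fun x => potential (liftConfig x)).bddAbove
  refine (PVASConfig.finite_bounded B).subset fun y hy => ?_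
  obtain ⟨x, hx, hxy⟩ := reachSet_extend h hy
  have hx : potential (liftConfig x) ≤ B := hB ⟨x, hx, rfl⟩
  have hy : potential y ≤ B := by
    rcases hxy with rfl | ⟨-, hp⟩
    · exact hx
    · exact hp.trans hx
  exact ⟨fun i => (counters_le_potential y i).trans hy, (length_le_potential y).trans hy⟩

/-- Emptying the stack adds its height to every counter, so one bound controls both. The hypothesis
`1 ≤ k` provides a counter, the one at index `0`, that records the height. -/
theorem bounded_of_counterBounded (h : ∀ t, t ∈ l ↔ t ∈ A.transitions) (hk : 1 ≤ k)
    (hA : (extend A l hl).CounterBounded) : A.Bounded := by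
  obtain ⟨c, hc⟩ := hA.bddAbove
  refine (PVASConfig.finite_bounded (∑ i, c i)).subset fun x hx => ?_
  have hle : ∀ i, c i ≤ ∑ i, c i := fun i =>
    Finset.single_le_sum (f := c) (fun _ _ => Nat.zero_le _) (Finset.mem_univ i)
  have hpop : (fun i => x.counters i + x.stack.length) ≤ c :=
    hc ⟨_, _, pop_mem_reachSet _ _ (enter_mem_reachSet h hx)⟩
  exact ⟨fun i => (Nat.le_add_right _ _).trans ((hpop i).trans (hle i)),
    (Nat.le_add_left _ _).trans ((hpop ⟨0, hk⟩).trans (hle _))⟩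

theorem bounded_of_stackBounded (h : ∀ t, t ∈ l ↔ t ∈ A.transitions)
    (hA : (extend A l hl).StackBounded) : A.Bounded := by
  obtain ⟨B, hB⟩ := (hA.image List.length).bddAbove
  refine (PVASConfig.finite_bounded B).subset fun x hx => ⟨fun i => ?_, ?_⟩
  · obtain ⟨d, v, hv, hd⟩ := push_mem_reachSet i _ _ _ rfl (enter_mem_reachSet h hx)
    have : v.length ≤ B := hB ⟨v, ⟨_, _, hd⟩, rfl⟩
    omega
  · have : (x.stack.map Fin.castSucc).length ≤ B :=
      hB ⟨_, ⟨_, _, enter_mem_reachSet h hx⟩, rfl⟩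
    simpa using this

theorem bounded_iff_counterBounded (h : ∀ t, t ∈ l ↔ t ∈ A.transitions) (hk : 1 ≤ k) :
    A.Bounded ↔ (extend A l hl).CounterBounded := by
  refine ⟨fun hA => ?_, bounded_of_counterBounded h hk⟩
  refine ((bounded_extend (hl := hl) h hA).image PVASConfig.counters).subset ?_
  rintro c ⟨q, w, hc⟩
  exact ⟨_, hc, rfl⟩

theorem bounded_iff_stackBounded (h : ∀ t, t ∈ l ↔ t ∈ A.transitions) :
    A.Bounded ↔ (extend A l hl).StackBounded := by
  refine ⟨fun hA => ?_, bounded_of_stackBounded h⟩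
  refine ((bounded_extend (hl := hl) h hA).image PVASConfig.stack).subset ?_
  rintro w ⟨q, c, hc⟩
  exact ⟨_, hc, rfl⟩

end Correctness

/-! ## The encoding of the extended system -/

/-- Since `Fin.castSucc` preserves values, the machine may copy old transitions verbatim. -/
theorem encodeTransition_liftTransition (t : PVASTransition k (Fin n) (Fin m)) :
    encodeTransition (liftTransition t) = encodeTransition t := by
  obtain ⟨p, a, op, q⟩ := t
  cases op <;> rfl

theorem flatMap_range {α : Type*} (f : ℕ → List α) (n : ℕ) :
    (List.range n).flatMap f = (List.finRange n).flatMap fun i : Fin n => f i := by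
  rw [← List.map_coe_finRange_eq_range, List.flatMap_map]

theorem encodeInteger_zero : encodeInteger 0 = [.plus, .comma] := by
  simp [encodeInteger, encodeBinary]

theorem encodeInteger_one : encodeInteger 1 = [.plus, .one, .comma] := by
  simp [encodeInteger, encodeBinary]

theorem encodeInteger_neg_one : encodeInteger (-1) = [.minus, .one, .comma] := by
  simp [encodeInteger, encodeBinary]

theorem flatMap_enter : ((List.finRange n).map (enter k m)).flatMap encodeTransition =
    enterWord k n := by
  rw [enterWord, flatMap_range, List.flatMap_map]
  congr 1
  funext q
  simp [encodeTransition, enter, encodeStackOp, flatMap_range, List.ofFn_eq_map,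
    List.flatMap_map, encodeInteger_zero]

theorem flatMap_popLoop : ((List.finRange m).map (popLoop k n)).flatMap encodeTransition =
    popWord k n m := by
  rw [popWord, flatMap_range, List.flatMap_map]
  congr 1
  funext q
  simp [encodeTransition, popLoop, encodeStackOp, flatMap_range, List.ofFn_eq_map,
    List.flatMap_map, encodeInteger_one]

theorem flatMap_pushLoop : ((List.finRange k).map (pushLoop n m)).flatMap encodeTransition =
    pushWord k n m := by
  rw [pushWord, flatMap_range, List.flatMap_map]
  congr 1
  funext q
  simp [encodeTransition, pushLoop, encodeStackOp, flatMap_range, List.ofFn_eq_map,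
    List.flatMap_map, apply_ite encodeInteger, encodeInteger_zero, encodeInteger_neg_one,
    Fin.ext_iff]

theorem done_notMem_encodeBinary (a : ℕ) : Letter.done ∉ encodeBinary a := by
  simp only [encodeBinary, List.mem_append, List.mem_map, List.mem_singleton, not_or, not_exists,
    reduceCtorEq, not_false_eq_true, and_true, not_and]
  intro b _
  cases b <;> simp

theorem done_notMem_encodeInteger (a : ℤ) : Letter.done ∉ encodeInteger a := by
  rw [encodeInteger, List.mem_cons, not_or]
  refine ⟨?_, done_notMem_encodeBinary _⟩
  split_ifs <;> simp

theorem done_notMem_encodeTransition (t : PVASTransition k (Fin n) (Fin m)) :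
    Letter.done ∉ encodeTransition t := by
  have hop : Letter.done ∉ encodeStackOp t.op := by
    cases t.op <;> simp [encodeStackOp, done_notMem_encodeBinary]
  simp [encodeTransition, done_notMem_encodeBinary, done_notMem_encodeInteger, hop]

/-- With `L = Nat.log 2 N`, the left side is at most `L + 3`; the factor 4 makes the inequality
strict even for `L = 0`. -/
theorem length_bits_lt {a N : ℕ} (h : a ≤ N) :
    a.bits.length + 2 < 4 * (Nat.log 2 N + 1) := by
  have : a.size ≤ Nat.log 2 N + 1 :=
    Nat.size_le.2 (h.trans_lt (Nat.lt_pow_succ_log_self one_lt_two N))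
  rw [Nat.size_eq_bits_len]
  omega

/-- On every encoding of `A`, the machine outputs an encoding of an extension of `A`. -/
theorem machine_computes_extend {A : PVAS k (Fin n) (Fin m)} {x : List Letter}
    (hx : A.EncodedBy x) :
    ∃ (l : List (PVASTransition k (Fin n) (Fin m))) (hl : l.Nodup) (y : List Letter),
      (∀ t, t ∈ l ↔ t ∈ A.transitions) ∧ (extend A l hl).EncodedBy y ∧
      machine.toTransducer.ComputesWithin x y (4 * (Nat.log 2 x.length + 1)) := by
  obtain ⟨l, hl, h, hx⟩ := hx
  refine ⟨l, hl, _, h, ⟨extendedTransitions l, nodup_extendedTransitions hl, fun _ => Iff.rfl, ?_⟩,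
    machine_computesWithin (k := k) (n := n) (m := m)
      (u := encodeBinary A.initState ++ (List.ofFn A.initCounters).flatMap encodeBinary ++
        A.initStack.flatMap (fun γ => encodeBinary γ))
      (v := l.flatMap encodeTransition) ?_ ?_ ?_ fun a => length_bits_lt⟩
  · rw [extendedTransitions, List.flatMap_append, List.flatMap_append, List.flatMap_append,
      flatMap_enter, flatMap_popLoop, flatMap_pushLoop, List.flatMap_map]
    simp [extend, encodeTransition_liftTransition, List.flatMap_map]
  · simp [done_notMem_encodeBinary]
  · simp [done_notMem_encodeTransition]
  · simp [hx]

theorem logspaceReducibleOn {D : Set PVASInstance} {P R : PVASInstance → Prop}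
    (h : ∀ I ∈ D, ∀ (l : List (PVASTransition I.dim (Fin I.numStates) (Fin I.numSymbols)))
      (hl : l.Nodup), (∀ t, t ∈ l ↔ t ∈ I.system.transitions) →
        (P I ↔ R ⟨I.dim, I.numStates + 1, I.numSymbols + 1, extend I.system l hl⟩)) :
    LogspaceReducibleOn D P R := by
  classical
  let space : List Letter → ℕ := fun x => 4 * (Nat.log 2 x.length + 1)
  -- The output depends on the order of transitions in `x`, so `f` is read off from the machine. The
  -- default `[]` never occurs on encodings.
  let f : List Letter → List Letter := fun x =>
    if hx : ∃ y, machine.toTransducer.ComputesWithin x y (space x) then hx.choose else []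
  have hf : ∀ x y, machine.toTransducer.ComputesWithin x y (space x) → f x = y := by
    intro x y hy
    have hx : ∃ y, machine.toTransducer.ComputesWithin x y (space x) := ⟨y, hy⟩
    simp only [f, dif_pos hx]
    exact hx.choose_spec.output_unique hy
  refine ⟨f, ⟨machine.toTransducer, 4, ?_⟩, ?_⟩
  · rintro x ⟨I, -, hx⟩
    obtain ⟨l, hl, y, -, -, hy⟩ := machine_computes_extend hx
    rwa [hf x y hy]
  · intro I hI x hx
    obtain ⟨l, hl, y, hlA, hy', hy⟩ := machine_computes_extend hx
    rw [hf x y hy]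
    exact ⟨⟨I.dim, I.numStates + 1, I.numSymbols + 1, extend I.system l hl⟩, hy', rfl,
      h I hI l hl hlA⟩

end Reduction

theorem mainTheorem3 :
    LogspaceReducibleOn {I | 1 ≤ I.dim}
      (fun I => I.system.Bounded) (fun I => I.system.CounterBounded) ∧
    LogspaceReducibleOn Set.univ
      (fun I => I.system.Bounded) (fun I => I.system.StackBounded) :=
  ⟨Reduction.logspaceReducibleOn fun _ hI _ hl h =>
      Reduction.bounded_iff_counterBounded (hl := hl) h hI,
    Reduction.logspaceReducibleOn fun _ _ _ hl h => Reduction.bounded_iff_stackBounded (hl := hl) h⟩
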